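/- For a $(0,1)$-matrix $M$ of size $n\times m$ and an integer $s\ge 1$, the $s$-binary rank $\mathrm{br}_s(M)$ is the least $d\ge 0$ such that there are sets $I_k\subseteq[n]$, $J_k\subseteq[m]$ ($k=1,\dots,d$) with $M[i,j]=1$ for all $(i,j)\in I_k\times J_k$ and all $k$, and such that every $(i,j)$ with $M[i,j]=1$ lies in at least one and at most $s$ of the rectangles $I_k\times J_k$. Write $\binom{d}{\le s}=\sum_{i=0}^{s}\binom di$. A non-adaptive one-sided error tester with parameter $\epsilon$ for a property $\mathcal P$ of $n\times m$ $(0,1)$-matrices is a randomized algorithm with query access to the entries of $M$ that fixes all its queries in advance (depending only on its random coins, not on the answers), accepts every $M\in\mathcal P$ with probability $1$, and rejects with probability at least $2/3$ every $M$ that is $\epsilon$-far from $\mathcal P$, i.e. such that every $N\in\mathcal P$ differs from $M$ in more than $\epsilon nm$ entries. Theorem. For all integers $s\ge 1$ and $d,n,m\ge 0$ and every real $0<\epsilon<1$ there is a non-adaptive one-sided error tester with parameter $\epsilon$ for the property $\mathrm{br}_s(M)\le d$ of $n\times m$ $(0,1)$-matrices, and there is also one for the property $\mathrm{br}_s(M)=d$,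 each making at most $$\tilde O\!\left(\binom{d}{\le s}\frac{2^d}{\epsilon^2}\right)$$ queries. Here $\tilde O(F)$ means at most $C\cdot F\cdot(1+\ln F)^c$, where $C$ and $c$ are absolute constants, independent of $s,d,n,m,\epsilon$. -/

import Mathlib

namespace RankTesting

/-- An `n × m` `(0,1)`-matrix (`true` is the entry `1`). -/
abbrev BMat (n m : ℕ) : Type := Matrix (Fin n) (Fin m) Bool

/-- `M` has `d` monochromatic rectangles `I k × J k` (all of whose entries are `1`) such that each
`1`-entry of `M` lies in at least one and at most `s` of them. -/
def HasCover {n m : ℕ} (s d : ℕ) (M : BMat n m) : Prop :=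
  ∃ (I : Fin d → Finset (Fin n)) (J : Fin d → Finset (Fin m)),
    (∀ k, ∀ i ∈ I k, ∀ j ∈ J k, M i j = true) ∧
    ∀ i j, M i j = true →
      1 ≤ (Finset.univ.filter fun k => i ∈ I k ∧ j ∈ J k).card ∧
        (Finset.univ.filter fun k => i ∈ I k ∧ j ∈ J k).card ≤ s

/-- The `s`-binary rank of `M`: the least number of rectangles in such a cover. -/
noncomputable def binaryRank {n m : ℕ} (s : ℕ) (M : BMat n m) : ℕ :=
  sInf {d | HasCover s d M}

/-- For `s ≥ 1` the infimum in `binaryRank` is a minimum: a cover exists (by single entries). -/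
theorem hasCover_binaryRank {n m : ℕ} {s : ℕ} (hs : 1 ≤ s) (M : BMat n m) :
    HasCover s (binaryRank s M) M := by
  refine Nat.sInf_mem (s := {d | HasCover s d M}) ⟨n * m, ?_⟩
  let e : Fin (n * m) ≃ Fin n × Fin m := finProdFinEquiv.symm
  refine ⟨fun k => if M (e k).1 (e k).2 = true then {(e k).1} else ∅,
    fun k => {(e k).2}, ?_, ?_⟩
  · intro k i hi j hj
    by_cases h : M (e k).1 (e k).2 = true
    · simp only [h, if_true, Finset.mem_singleton] at hi hj
      rw [hi, hj, h]
    · simp [h] at hi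
  · intro i j hij
    have key : (Finset.univ.filter fun k =>
        i ∈ (if M (e k).1 (e k).2 = true then ({(e k).1} : Finset (Fin n)) else ∅) ∧
          j ∈ ({(e k).2} : Finset (Fin m))) = {e.symm (i, j)} := by
      ext k
      simp only [Finset.mem_filter, Finset.mem_univ, true_and, Finset.mem_singleton]
      constructor
      · rintro ⟨h1, h2⟩
        by_cases h : M (e k).1 (e k).2 = true
        · simp only [h, if_true, Finset.mem_singleton] at h1
          rw [Equiv.eq_symm_apply]
          exact Prod.ext h1.symm h2.symm
        · simp [h] at h1
      · rintro rfl
        simp [hij]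
    rw [key]
    simpa using hs

/-- The number of entries in which two matrices differ. -/
def numDiff {n m : ℕ} (M N : BMat n m) : ℕ :=
  (Finset.univ.filter fun p : Fin n × Fin m => M p.1 p.2 ≠ N p.1 p.2).card

/-- `M` is `ε`-far from `P`: more than an `ε`-fraction of the entries of `M` has to be modified
to get a matrix with property `P`. -/
def IsFar {n m : ℕ} (ε : ℝ) (P : BMat n m → Prop) (M : BMat n m) : Prop :=
  ∀ N, P N → ε * ((n : ℝ) * (m : ℝ)) < (numDiff M N : ℝ)

/-- A randomized non-adaptive query algorithm on `n × m` `(0,1)`-matrices: the coins alone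
determine the positions of all `numQueries` queries (counted with repetitions), and the output
(`true` means "accept") depends only on the coins and on the answers to these queries. -/
structure NonadaptiveAlgorithm (n m : ℕ) where
  Coins : Type
  law : PMF Coins
  numQueries : ℕ
  query : Coins → Fin numQueries → Fin n × Fin m
  decision : Coins → (Fin numQueries → Bool) → Bool

/-- The distribution of the output of `A` when the entries of `M` are queried. -/
noncomputable def NonadaptiveAlgorithm.output {n m : ℕ} (A : NonadaptiveAlgorithm n m)
    (M : BMat n m) : PMF Bool :=
  A.law.map fun r => A.decision r fun q => M (A.query r q).1 (A.query r q).2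

/-- `A` is a one-sided error tester for `P` with distance parameter `ε`: it accepts every matrix
with property `P` with probability `1`, and rejects every matrix that is `ε`-far from `P` with
probability at least `2/3`. -/
def NonadaptiveAlgorithm.IsOneSidedTester {n m : ℕ} (A : NonadaptiveAlgorithm n m) (ε : ℝ)
    (P : BMat n m → Prop) : Prop :=
  (∀ M, P M → A.output M true = 1) ∧ ∀ M, IsFar ε P M → 2 / 3 ≤ A.output M false

/-- `∑_{i=0}^{s} (d choose i)`. -/
def chooseLe (d s : ℕ) : ℕ := ∑ i ∈ Finset.range (s + 1), d.choose i

/-- The quantity `(∑_{i=0}^{s} (d choose i)) * 2 ^ d / ε ^ 2`. -/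
noncomputable def queryScale (s d : ℕ) (ε : ℝ) : ℝ := (chooseLe d s : ℝ) * 2 ^ d / ε ^ 2

end RankTesting

/-! A cover attaches to every row and every column the set of rectangles that involve it. An entry
is `1` exactly when its two sets meet, and they then share at most `s` elements. Sgall's inequality
bounds the product of the sizes of two such families by `K = chooseLe d s * 2 ^ d`. Hence rows `X`
and columns `Y` that are pairwise distinct inside a coverable `X × Y` satisfy `X.card * Y.card ≤ K`
(`Coverable.card_mul_card_le`).

Let `M` be far while `X × Y` is still coverable. Replacing each row and column by a representative
in `X` and `Y` yields a matrix of rank at most `d`, which must disagree with `M` often. So an `ε /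
3` fraction of the rows, of the columns or of the row-column pairs enlarges `X × Y` and keeps it
separated (`IsFar.expansion`). A block of about `log K / ε` samples misses such a set with
probability at most `1 / (6 K)`. At most `2 K` blocks are consumed, so with probability at least
`2/3` the growth ends in a submatrix that is not coverable (`IsFar.mul_card_not_reached_le`). One
step at most quadruples `X.card * Y.card`, so the final product is at most `4 K`.

The queries need no adaptivity: a certificate `X' × Y'` uses only the first `X'.card` row blocks and
the first `Y'.card` column blocks. It suffices to query the pairs of blocks `u`, `w` with `(u + 1) *
(w + 1) ≤ 4 K`, and a harmonic sum leaves only `O(K log K)` of them.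

For rank exactly `d`, a long matrix of rank at most `d` is close to one of rank `d`, so the first
tester applies with `ε / 2`; a short one has few enough entries to be read completely. -/

namespace RankTesting
open Finset

/-! ### Sgall's inequality for cross-intersecting set families -/

section SetFamilies
variable {α : Type*} [DecidableEq α]

theorem sum_choose_succ (n t : ℕ) :
    ∑ i ∈ range (t + 1), (n + 1).choose i =
      ∑ i ∈ range (t + 1), n.choose i + ∑ i ∈ range t, n.choose i := by
  rw [sum_range_succ' (fun i => (n + 1).choose i), sum_range_succ' (fun i => n.choose i)]
  simp only [Nat.choose_succ_succ, sum_add_distrib, Nat.choose_zero_right]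
  ring

/-- Two lower families of subsets of `S` whose cross intersections have fewer than `t` elements. -/
theorem card_mul_card_le_of_isLowerSet (S : Finset α) :
    ∀ (t : ℕ) (𝒜 ℬ : Finset (Finset α)), IsLowerSet (𝒜 : Set (Finset α)) →
      IsLowerSet (ℬ : Set (Finset α)) → (∀ A ∈ 𝒜, A ⊆ S) → (∀ B ∈ ℬ, B ⊆ S) →
      (∀ A ∈ 𝒜, ∀ B ∈ ℬ, (A ∩ B).card < t) →
      𝒜.card * ℬ.card ≤ (∑ i ∈ range t, S.card.choose i) * 2 ^ S.card := by
  have zero : ∀ 𝒜 ℬ : Finset (Finset α), (∀ A ∈ 𝒜, ∀ B ∈ ℬ, (A ∩ B).card < 0) →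
      𝒜.card * ℬ.card = 0 := by
    intro 𝒜 ℬ h
    rcases 𝒜.eq_empty_or_nonempty with rfl | ⟨A, hA⟩
    · simp
    rcases ℬ.eq_empty_or_nonempty with rfl | ⟨B, hB⟩
    · simp
    exact absurd (h A hA B hB) (Nat.not_lt_zero _)
  induction S using Finset.induction_on with
  | empty =>
    intro t 𝒜 ℬ _ _ hA hB h
    cases t with
    | zero => simp [zero 𝒜 ℬ h]
    | succ t =>
      have hc : ∀ 𝒞 : Finset (Finset α), (∀ A ∈ 𝒞, A ⊆ ∅) → 𝒞.card ≤ 1 := by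
        intro 𝒞 hC
        refine card_le_one.2 fun A hA B hB => ?_
        rw [subset_empty.1 (hC A hA), subset_empty.1 (hC B hB)]
      rw [sum_range_succ']
      have := Nat.mul_le_mul (hc 𝒜 hA) (hc ℬ hB)
      simp only [card_empty, Nat.choose_zero_right, pow_zero]
      omega
  | insert a S ha ih =>
    intro t 𝒜 ℬ lA lB hA hB h
    cases t with
    | zero => simp [zero 𝒜 ℬ h]
    | succ t =>
      have hmem : ∀ 𝒞 : Finset (Finset α), (∀ A ∈ 𝒞, A ⊆ insert a S) →
          ∀ A ∈ 𝒞.memberSubfamily a, A ⊆ S := by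
        intro 𝒞 hC A hA x hx
        rw [mem_memberSubfamily] at hA
        have := hC _ hA.1 (mem_insert_of_mem hx)
        rcases mem_insert.1 this with rfl | h
        · exact absurd hx hA.2
        · exact h
      have hnon : ∀ 𝒞 : Finset (Finset α), (∀ A ∈ 𝒞, A ⊆ insert a S) →
          ∀ A ∈ 𝒞.nonMemberSubfamily a, A ⊆ S := by
        intro 𝒞 hC A hA x hx
        rw [mem_nonMemberSubfamily] at hA
        rcases mem_insert.1 (hC _ hA.1 hx) with rfl | h
        · exact absurd hx hA.2
        · exact h
      -- Split both families by membership of `a`. Sets that contain `a` lose one common element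
      -- when `a` is removed, so the bound for that part drops from `t + 1` to `t`.
      have h0 := ih (t + 1) (𝒜.nonMemberSubfamily a) (ℬ.nonMemberSubfamily a)
        lA.nonMemberSubfamily lB.nonMemberSubfamily (hnon _ hA) (hnon _ hB)
        (fun A hA B hB => h A (mem_nonMemberSubfamily.1 hA).1 B (mem_nonMemberSubfamily.1 hB).1)
      have h1 := ih t (𝒜.memberSubfamily a) (ℬ.memberSubfamily a)
        lA.memberSubfamily lB.memberSubfamily (hmem _ hA) (hmem _ hB)
        (fun A hA B hB => by
          rw [mem_memberSubfamily] at hA hB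
          have := h _ hA.1 _ hB.1
          rw [← insert_inter_distrib, card_insert_of_notMem
            (fun hx => hA.2 (mem_inter.1 hx).1)] at this
          omega)
      have mA := card_le_card (lA.memberSubfamily_subset_nonMemberSubfamily (a := a))
      have mB := card_le_card (lB.memberSubfamily_subset_nonMemberSubfamily (a := a))
      rw [← card_memberSubfamily_add_card_nonMemberSubfamily a 𝒜,
        ← card_memberSubfamily_add_card_nonMemberSubfamily a ℬ, card_insert_of_notMem ha,
        sum_choose_succ, pow_succ]
      -- With `a₁ ≤ a₀` and `b₁ ≤ b₀` for the sizes of the parts, `(a₀ - a₁) * (b₀ - b₁) ≥ 0` gives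
      -- `(a₀ + a₁) * (b₀ + b₁) ≤ 2 * (a₀ * b₀ + a₁ * b₁)`; Pascal's rule adds up the two inductive
      -- bounds.
      obtain ⟨x, hx⟩ := Nat.exists_eq_add_of_le mA
      obtain ⟨y, hy⟩ := Nat.exists_eq_add_of_le mB
      rw [hx, hy] at h0 ⊢
      nlinarith [Nat.zero_le (x * y)]

/-- Sgall's bound for pairs of families with cross intersections of at most `s` elements. -/
theorem card_mul_card_le_of_card_inter_le [Fintype α] (s : ℕ) (𝒜 ℬ : Finset (Finset α))
    (h : ∀ A ∈ 𝒜, ∀ B ∈ ℬ, (A ∩ B).card ≤ s) :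
    𝒜.card * ℬ.card ≤ chooseLe (Fintype.card α) s * 2 ^ Fintype.card α := by
  classical
  -- Closing downwards enlarges the families, and intersections of subsets are no larger.
  let down (𝒞 : Finset (Finset α)) : Finset (Finset α) := univ.filter fun B => ∃ A ∈ 𝒞, B ⊆ A
  have hsub : ∀ 𝒞, 𝒞 ⊆ down 𝒞 := fun 𝒞 A hA => by
    simp only [down, mem_filter, mem_univ, true_and]
    exact ⟨A, hA, Subset.rfl⟩
  have hlow : ∀ 𝒞, IsLowerSet (down 𝒞 : Set (Finset α)) := by
    intro 𝒞 A B hBA hA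
    simp only [down, coe_filter, mem_univ, true_and, Set.mem_ofPred_eq] at hA ⊢
    obtain ⟨C, hC, hAC⟩ := hA
    exact ⟨C, hC, subset_trans hBA hAC⟩
  have := card_mul_card_le_of_isLowerSet univ (s + 1) (down 𝒜) (down ℬ) (hlow 𝒜) (hlow ℬ)
    (fun _ _ => subset_univ _) (fun _ _ => subset_univ _) (by
      intro A hA B hB
      simp only [down, mem_filter, mem_univ, true_and] at hA hB
      obtain ⟨A', hA', hA⟩ := hA
      obtain ⟨B', hB', hB⟩ := hB
      exact Nat.lt_succ_of_le ((card_le_card (inter_subset_inter hA hB)).trans (h A' hA' B' hB')))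
  exact (Nat.mul_le_mul (card_le_card (hsub 𝒜)) (card_le_card (hsub ℬ))).trans this

end SetFamilies

/-! ### Covers by rectangles and the size of separated submatrices -/

section Covers
variable {n m s d : ℕ}

theorem HasCover.mono {d' : ℕ} {M : BMat n m} (h : HasCover s d M) (hd : d ≤ d') :
    HasCover s d' M := by
  obtain ⟨e, rfl⟩ := Nat.exists_eq_add_of_le hd
  obtain ⟨I, J, h1, h2⟩ := h
  refine ⟨Fin.append I fun _ => ∅, Fin.append J fun _ => ∅, ?_, ?_⟩
  · intro k
    refine Fin.addCases (fun k => ?_) (fun k => ?_) k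
    · simpa using h1 k
    · simp
  · intro i j hij
    have : (univ.filter fun k => i ∈ Fin.append I (fun _ : Fin e => ∅) k ∧
        j ∈ Fin.append J (fun _ : Fin e => ∅) k) =
        (univ.filter fun k => i ∈ I k ∧ j ∈ J k).map (Fin.castAddEmb e) := by
      ext k
      refine Fin.addCases (fun k => ?_) (fun k => ?_) k
      · simp
      · simp [Fin.ext_iff]
        intro x _ _ hx
        have := x.2
        omega
    rw [this, card_map]
    exact h2 i j hij

theorem binaryRank_le_iff (hs : 1 ≤ s) {M : BMat n m} : binaryRank s M ≤ d ↔ HasCover s d M :=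
  ⟨fun h => (hasCover_binaryRank hs M).mono h, fun h => Nat.sInf_le h⟩

/-- Pulling a cover back along maps of the rows and of the columns. -/
theorem HasCover.comp {n' m' : ℕ} {M : BMat n m} (h : HasCover s d M) (φ : Fin n' → Fin n)
    (ψ : Fin m' → Fin m) : HasCover s d (fun i j => M (φ i) (ψ j) : BMat n' m') := by
  obtain ⟨I, J, h1, h2⟩ := h
  refine ⟨fun k => univ.filter fun i => φ i ∈ I k, fun k => univ.filter fun j => ψ j ∈ J k, ?_, ?_⟩
  · intro k i hi j hj
    simp only [mem_filter, mem_univ, true_and] at hi hj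
    exact h1 k _ hi _ hj
  · intro i j hij
    simpa using h2 _ _ hij

/-- Cutting rows and columns out of a cover. -/
theorem HasCover.restrict {M : BMat n m} (h : HasCover s d M) (p : Fin n → Fin m → Bool)
    (A : Finset (Fin n)) (B : Finset (Fin m)) (hp : ∀ i j, p i j = true ↔ i ∉ A ∧ j ∉ B) :
    HasCover s d (fun i j => M i j && p i j : BMat n m) := by
  obtain ⟨I, J, h1, h2⟩ := h
  refine ⟨fun k => I k \ A, fun k => J k \ B, ?_, ?_⟩
  · intro k i hi j hj
    rw [mem_sdiff] at hi hj
    simp [h1 k i hi.1 j hj.1, (hp i j).2 ⟨hi.2, hj.2⟩]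
  · intro i j hij
    simp only [Bool.and_eq_true] at hij
    have := (hp i j).1 hij.2
    simpa [mem_sdiff, this.1, this.2] using h2 i j hij.1

/-- A `1` can be added to a matrix at the cost of one rectangle. -/
theorem HasCover.succ_of_single (hs : 1 ≤ s) {M N : BMat n m} (h : HasCover s d M) (a : Fin n)
    (b : Fin m) (hab : M a b = false) (hN : ∀ i j, N i j = true ↔ M i j = true ∨ i = a ∧ j = b) :
    HasCover s (d + 1) N := by
  obtain ⟨I, J, h1, h2⟩ := h
  refine ⟨Fin.cons {a} I, Fin.cons {b} J, ?_, ?_⟩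
  · intro k
    refine Fin.cases ?_ (fun k => ?_) k
    · simp [hN]
    · simp only [Fin.cons_succ]
      exact fun i hi j hj => (hN i j).2 (Or.inl (h1 k i hi j hj))
  · intro i j hij
    rw [Fin.card_filter_univ_succ]
    by_cases hc : i = a ∧ j = b
    · obtain ⟨rfl, rfl⟩ := hc
      -- The entry was `0`, so no old rectangle contains it and the new one covers it exactly once.
      have : (univ.filter fun k => i ∈ I k ∧ j ∈ J k) = ∅ := by
        rw [filter_eq_empty_iff]
        intro k _ hk
        have := h1 k i hk.1 j hk.2
        rw [hab] at this
        exact absurd this (by simp)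
      simp [this, hs]
    · have hM := h2 i j (((hN i j).1 hij).resolve_right hc)
      simpa [hc] using hM

theorem HasCover.rows (hs : 1 ≤ s) (M : BMat n m) : HasCover s n M := by
  refine ⟨fun k => {k}, fun k => univ.filter fun j => M k j = true, ?_, ?_⟩
  · intro k i hi j hj
    simp only [mem_singleton, mem_filter, mem_univ, true_and] at hi hj
    rw [hi, hj]
  · intro i j hij
    have : (univ.filter fun k => i ∈ ({k} : Finset (Fin n)) ∧
        j ∈ univ.filter fun j => M k j = true) = {i} := by
      ext k
      simp only [mem_singleton, mem_filter, mem_univ, true_and]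
      constructor
      · exact fun h => h.1.symm
      · rintro rfl
        exact ⟨rfl, hij⟩
    rw [this]
    simpa using hs

theorem HasCover.columns (hs : 1 ≤ s) (M : BMat n m) : HasCover s m M := by
  refine ⟨fun k => univ.filter fun i => M i k = true, fun k => {k}, ?_, ?_⟩
  · intro k i hi j hj
    simp only [mem_singleton, mem_filter, mem_univ, true_and] at hi hj
    rw [hj, hi]
  · intro i j hij
    have : (univ.filter fun k => i ∈ (univ.filter fun i => M i k = true) ∧
        j ∈ ({k} : Finset (Fin m))) = {j} := by
      ext k
      simp only [mem_singleton, mem_filter, mem_univ, true_and]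
      constructor
      · exact fun h => h.2.symm
      · rintro rfl
        exact ⟨hij, rfl⟩
    rw [this]
    simpa using hs

/-- A fooling set of `e` entries forces at least `e` rectangles. -/
theorem HasCover.le_of_fooling {e : ℕ} {M : BMat n m} (h : HasCover s d M) (r : Fin e → Fin n)
    (c : Fin e → Fin m) (hone : ∀ t, M (r t) (c t) = true)
    (hzero : ∀ t u, t ≠ u → M (r t) (c u) = false ∨ M (r u) (c t) = false) : e ≤ d := by
  obtain ⟨I, J, h1, h2⟩ := h
  have hk : ∀ t, ∃ k, r t ∈ I k ∧ c t ∈ J k := by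
    intro t
    obtain ⟨k, hk⟩ := card_pos.1 (h2 _ _ (hone t)).1
    exact ⟨k, (mem_filter.1 hk).2⟩
  choose k hk using hk
  -- A rectangle containing two of the entries would contain both crossing entries, one of which is
  -- `0`.
  have : Function.Injective k := by
    intro t u htu
    by_contra hne
    have a := h1 (k t) _ (hk t).1 _ (htu ▸ (hk u).2)
    have b := h1 (k t) _ (htu ▸ (hk u).1) _ (hk t).2
    rcases hzero t u hne with h | h
    · simp [h] at a
    · simp [h] at b
  simpa using Fintype.card_le_of_injective k this

/-- The rows `X` and the columns `Y` are pairwise distinct inside `X × Y`. -/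
def Separated (M : BMat n m) (X : Finset (Fin n)) (Y : Finset (Fin m)) : Prop :=
  (∀ x ∈ X, ∀ x' ∈ X, (∀ y ∈ Y, M x y = M x' y) → x = x') ∧
    ∀ y ∈ Y, ∀ y' ∈ Y, (∀ x ∈ X, M x y = M x y') → y = y'

/-- The rectangles through a row determine the row, so separation makes `R` and `C` injective on `X`
and `Y`. Their values meet in at most `s` rectangles: none at a `0`, at most `s` at a `1`. -/
theorem HasCover.card_mul_card_le {M : BMat n m} (h : HasCover s d M) {X : Finset (Fin n)}
    {Y : Finset (Fin m)} (hsep : Separated M X Y) : X.card * Y.card ≤ chooseLe d s * 2 ^ d := by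
  classical
  obtain ⟨I, J, h1, h2⟩ := h
  let R : Fin n → Finset (Fin d) := fun i => univ.filter fun k => i ∈ I k
  let C : Fin m → Finset (Fin d) := fun j => univ.filter fun k => j ∈ J k
  have hRC : ∀ i j, R i ∩ C j = univ.filter fun k => i ∈ I k ∧ j ∈ J k := fun i j => by
    ext k; simp [R, C]
  have hM : ∀ i j, M i j = true ↔ (R i ∩ C j).Nonempty := by
    intro i j
    rw [hRC]
    constructor
    · exact fun hij => card_pos.1 (h2 i j hij).1
    · rintro ⟨k, hk⟩
      exact h1 k i (mem_filter.1 hk).2.1 j (mem_filter.1 hk).2.2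
  have hR : Set.InjOn R X := fun x hx x' hx' hxx' => hsep.1 x hx x' hx' fun y _ => by
    rw [Bool.eq_iff_iff, hM, hM, hxx']
  have hC : Set.InjOn C Y := fun y hy y' hy' hyy' => hsep.2 y hy y' hy' fun x _ => by
    rw [Bool.eq_iff_iff, hM, hM, hyy']
  have := card_mul_card_le_of_card_inter_le s (X.image R) (Y.image C) (by
    intro A hA B hB
    obtain ⟨i, _, rfl⟩ := mem_image.1 hA
    obtain ⟨j, _, rfl⟩ := mem_image.1 hB
    by_cases hij : M i j = true
    · rw [hRC]
      exact (h2 i j hij).2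
    · rw [hM, not_nonempty_iff_eq_empty] at hij
      simp [hij])
  rwa [card_image_of_injOn hR, card_image_of_injOn hC, Fintype.card_fin] at this

end Covers
-- Probability estimates by counting samples
section Counting
open Classical

/-- Conditioning on the first factor of a finite product. -/
theorem mul_card_filter_le_of_equiv {A B Ω : Type*} [Fintype A] [Fintype B] [Fintype Ω]
    (e : A × B ≃ Ω) (Q : Ω → Prop) (bad : A → Prop) {D t : ℕ}
    (hbad : D * (univ.filter bad).card ≤ Fintype.card A)
    (h : ∀ a, ¬ bad a → D * (univ.filter fun b => Q (e (a, b))).card ≤ t * Fintype.card B) :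
    D * (univ.filter Q).card ≤ (t + 1) * Fintype.card Ω := by
  have hQ : (univ.filter Q).card = ∑ a, (univ.filter fun b => Q (e (a, b))).card := by
    simp only [card_filter]
    rw [← Equiv.sum_comp e, Fintype.sum_prod_type]
  have hstep : ∀ a, D * (univ.filter fun b => Q (e (a, b))).card ≤
      (if bad a then 1 else 0) * (D * Fintype.card B) + t * Fintype.card B := by
    -- A bad first coordinate is charged with all its extensions. These are at most a `1 / D` share
    -- of the total, which accounts for the extra `1` in `t + 1`.
    intro a
    by_cases ha : bad a
    · rw [if_pos ha, one_mul]
      exact (Nat.mul_le_mul_left D (card_le_univ _)).trans (Nat.le_add_right _ _)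
    · rw [if_neg ha, zero_mul, zero_add]
      exact h a ha
  calc D * (univ.filter Q).card
      = ∑ a, D * (univ.filter fun b => Q (e (a, b))).card := by rw [hQ, mul_sum]
    _ ≤ ∑ a, ((if bad a then 1 else 0) * (D * Fintype.card B) + t * Fintype.card B) :=
        sum_le_sum fun a _ => hstep a
    _ = D * (univ.filter bad).card * Fintype.card B +
          Fintype.card A * (t * Fintype.card B) := by
        rw [sum_add_distrib, ← sum_mul, ← card_filter, sum_const, card_univ, smul_eq_mul]
        ring
    _ ≤ Fintype.card A * Fintype.card B + Fintype.card A * (t * Fintype.card B) := by gcongr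
    _ = (t + 1) * Fintype.card Ω := by
        rw [← Fintype.card_congr e, Fintype.card_prod]
        ring

/-- The number of samples of size `L` that miss a set of density at least `δ`. -/
theorem mul_card_miss_le {α : Type*} [Fintype α] {L D : ℕ} {δ : ℝ}
    (hD : (1 - δ) ^ L * D ≤ 1) (S : Finset α) (hS : δ * Fintype.card α ≤ S.card)
    (bad : (Fin L → α) → Prop) (hbad : ∀ v, bad v → ∀ l, v l ∉ S) :
    D * (univ.filter bad).card ≤ Fintype.card (Fin L → α) := by
  have hsub : univ.filter bad ⊆ Fintype.piFinset fun _ : Fin L => Sᶜ := by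
    intro v hv
    simpa using hbad v (mem_filter.1 hv).2
  have hcompl : ((Sᶜ.card : ℕ) : ℝ) ≤ (1 - δ) * Fintype.card α := by
    rw [card_compl, Nat.cast_sub (card_le_univ S)]
    linarith
  have hcard := card_le_card hsub
  rw [Fintype.card_piFinset_const] at hcard
  refine (Nat.mul_le_mul_left D hcard).trans ?_
  rw [Fintype.card_fun, Fintype.card_fin]
  have h : (D : ℝ) * (Sᶜ.card : ℝ) ^ L ≤ (Fintype.card α : ℝ) ^ L :=
    calc (D : ℝ) * (Sᶜ.card : ℝ) ^ L ≤ D * ((1 - δ) * Fintype.card α) ^ L := by gcongr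
      _ = ((1 - δ) ^ L * D) * (Fintype.card α : ℝ) ^ L := by rw [mul_pow]; ring
      _ ≤ 1 * (Fintype.card α : ℝ) ^ L := by gcongr
      _ = _ := one_mul _
  exact_mod_cast h

/-- Matching the `l`-th row with the `l`-th column of two blocks gives `L` independent uniform
pairs. -/
theorem mul_card_pair_miss_le {α β : Type*} [Fintype α] [Fintype β] {L D : ℕ} {δ : ℝ}
    (hD : (1 - δ) ^ L * D ≤ 1) (S : Finset (α × β))
    (hS : δ * Fintype.card (α × β) ≤ S.card) (bad : (Fin L → α) × (Fin L → β) → Prop)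
    (hbad : ∀ v, bad v → ∀ l, (v.1 l, v.2 l) ∉ S) :
    D * (univ.filter bad).card ≤ Fintype.card ((Fin L → α) × (Fin L → β)) := by
  let e : (Fin L → α × β) ≃ (Fin L → α) × (Fin L → β) := Equiv.arrowProdEquivProdArrow _ _ _
  have h := mul_card_miss_le hD S hS (fun v => bad (e v)) fun v hv => hbad _ hv
  have heq : (univ.filter bad).card = (univ.filter fun v => bad (e v)).card := by
    simp only [card_filter]
    rw [← Equiv.sum_comp e]
  rw [heq, ← Fintype.card_congr e]
  exact h

/-- Splitting off the first term of the first sequence. -/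
def consLeft (ρ κ : Type*) (p q : ℕ) :
    ρ × ((Fin p → ρ) × (Fin q → κ)) ≃ (Fin (p + 1) → ρ) × (Fin q → κ) where
  toFun a := (Fin.cons a.1 a.2.1, a.2.2)
  invFun w := (w.1 0, Fin.tail w.1, w.2)
  left_inv a := by simp
  right_inv w := by simp

/-- Splitting off the first term of the second sequence. -/
def consRight (ρ κ : Type*) (p q : ℕ) :
    κ × ((Fin p → ρ) × (Fin q → κ)) ≃ (Fin p → ρ) × (Fin (q + 1) → κ) where
  toFun a := (a.2.1, Fin.cons a.1 a.2.2)
  invFun w := (w.2 0, w.1, Fin.tail w.2)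
  left_inv a := by simp
  right_inv w := by simp

/-- Splitting off the first terms of both sequences. -/
def consBoth (ρ κ : Type*) (p q : ℕ) :
    (ρ × κ) × ((Fin p → ρ) × (Fin q → κ)) ≃ (Fin (p + 1) → ρ) × (Fin (q + 1) → κ) where
  toFun a := (Fin.cons a.1.1 a.2.1, Fin.cons a.1.2 a.2.2)
  invFun w := ((w.1 0, w.2 0), Fin.tail w.1, Fin.tail w.2)
  left_inv a := by simp
  right_inv w := by simp

end Counting

/-! ### Growing a separated submatrix of a far matrix -/

section Expansion
open Classical
variable {n m s d : ℕ}

/-- Row `i` differs inside `Y` from all rows in `X`. -/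
def NewRow (M : BMat n m) (X : Finset (Fin n)) (Y : Finset (Fin m)) (i : Fin n) : Prop :=
  ∀ x ∈ X, ∃ y ∈ Y, M x y ≠ M i y

/-- Column `j` differs inside `X` from all columns in `Y`. -/
def NewColumn (M : BMat n m) (X : Finset (Fin n)) (Y : Finset (Fin m)) (j : Fin m) : Prop :=
  ∀ y ∈ Y, ∃ x ∈ X, M x y ≠ M x j

/-- `M` agrees on `X × Y` with a matrix of `s`-binary rank at most `d`. -/
def Coverable (s d : ℕ) (M : BMat n m) (X : Finset (Fin n)) (Y : Finset (Fin m)) : Prop :=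
  ∃ N : BMat n m, HasCover s d N ∧ ∀ i ∈ X, ∀ j ∈ Y, N i j = M i j

theorem NewRow.notMem {M : BMat n m} {X : Finset (Fin n)} {Y : Finset (Fin m)} {i : Fin n}
    (h : NewRow M X Y i) : i ∉ X := fun hi => by
  obtain ⟨y, _, hy⟩ := h i hi
  exact hy rfl

theorem NewColumn.notMem {M : BMat n m} {X : Finset (Fin n)} {Y : Finset (Fin m)} {j : Fin m}
    (h : NewColumn M X Y j) : j ∉ Y := fun hj => by
  obtain ⟨x, _, hx⟩ := h j hj
  exact hx rfl

theorem rows_separated_insert {M : BMat n m} {X : Finset (Fin n)} {Y Y' : Finset (Fin m)}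
    {i : Fin n} (h : ∀ x ∈ X, ∀ x' ∈ X, (∀ y ∈ Y, M x y = M x' y) → x = x') (hY : Y ⊆ Y')
    (hi : NewRow M X Y' i) :
    ∀ x ∈ insert i X, ∀ x' ∈ insert i X, (∀ y ∈ Y', M x y = M x' y) → x = x' := by
  intro x hx x' hx' hxx'
  rcases mem_insert.1 hx with rfl | hx1
  · rcases mem_insert.1 hx' with rfl | hx'
    · rfl
    · obtain ⟨y, hy, hne⟩ := hi x' hx'
      exact absurd (hxx' y hy).symm hne
  · rcases mem_insert.1 hx' with rfl | hx'
    · obtain ⟨y, hy, hne⟩ := hi x hx1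
      exact absurd (hxx' y hy) hne
    · exact h x hx1 x' hx' fun y hy => hxx' y (hY hy)

theorem columns_separated_insert {M : BMat n m} {X X' : Finset (Fin n)} {Y : Finset (Fin m)}
    {j : Fin m} (h : ∀ y ∈ Y, ∀ y' ∈ Y, (∀ x ∈ X, M x y = M x y') → y = y') (hX : X ⊆ X')
    (hj : NewColumn M X' Y j) :
    ∀ y ∈ insert j Y, ∀ y' ∈ insert j Y, (∀ x ∈ X', M x y = M x y') → y = y' := by
  intro y hy y' hy' hyy'
  rcases mem_insert.1 hy with rfl | hy1
  · rcases mem_insert.1 hy' with rfl | hy'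
    · rfl
    · obtain ⟨x, hx, hne⟩ := hj y' hy'
      exact absurd (hyy' x hx).symm hne
  · rcases mem_insert.1 hy' with rfl | hy'
    · obtain ⟨x, hx, hne⟩ := hj y hy1
      exact absurd (hyy' x hx) hne
    · exact h y hy1 y' hy' fun x hx => hyy' x (hX hx)

theorem Separated.insert_row {M : BMat n m} {X : Finset (Fin n)} {Y : Finset (Fin m)} {i : Fin n}
    (h : Separated M X Y) (hi : NewRow M X Y i) : Separated M (insert i X) Y :=
  ⟨rows_separated_insert h.1 Subset.rfl hi,
    fun y hy y' hy' hyy' => h.2 y hy y' hy' fun x hx => hyy' x (mem_insert_of_mem hx)⟩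

theorem Separated.insert_column {M : BMat n m} {X : Finset (Fin n)} {Y : Finset (Fin m)}
    {j : Fin m} (h : Separated M X Y) (hj : NewColumn M X Y j) : Separated M X (insert j Y) :=
  ⟨fun x hx x' hx' hxx' => h.1 x hx x' hx' fun y hy => hxx' y (mem_insert_of_mem hy),
    columns_separated_insert h.2 Subset.rfl hj⟩

theorem Separated.insert_both {M : BMat n m} {X : Finset (Fin n)} {Y : Finset (Fin m)}
    {i : Fin n} {j : Fin m} (h : Separated M X Y) (hi : NewRow M X (insert j Y) i)
    (hj : NewColumn M (insert i X) Y j) : Separated M (insert i X) (insert j Y) :=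
  ⟨rows_separated_insert h.1 (subset_insert _ _) hi,
    columns_separated_insert h.2 (subset_insert _ _) hj⟩

theorem Coverable.card_mul_card_le {M : BMat n m} {X : Finset (Fin n)} {Y : Finset (Fin m)}
    (h : Coverable s d M X Y) (hsep : Separated M X Y) :
    X.card * Y.card ≤ chooseLe d s * 2 ^ d := by
  obtain ⟨N, hN, hNM⟩ := h
  refine hN.card_mul_card_le ⟨fun x hx x' hx' hxx' => hsep.1 x hx x' hx' fun y hy => ?_,
    fun y hy y' hy' hyy' => hsep.2 y hy y' hy' fun x hx => ?_⟩
  · rw [← hNM x hx y hy, ← hNM x' hx' y hy, hxx' y hy]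
  · rw [← hNM x hx y hy, ← hNM x hx y' hy', hyy' x hx]

/-- If `M` is far from having `s`-binary rank at most `d` but looks so on `X × Y`, then many rows,
many columns or many pairs of a row and a column extend `X × Y`. -/
theorem IsFar.expansion {ε : ℝ} {M : BMat n m} (hfar : IsFar ε (HasCover s d) M)
    {X : Finset (Fin n)} {Y : Finset (Fin m)} (hX : X.Nonempty) (hY : Y.Nonempty)
    (hsep : Separated M X Y) (hcov : Coverable s d M X Y) :
    ε / 3 * n ≤ (univ.filter (NewRow M X Y)).card ∨
    ε / 3 * m ≤ (univ.filter (NewColumn M X Y)).card ∨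
    ε / 3 * (n * m) ≤ (univ.filter fun p : Fin n × Fin m =>
      NewRow M X (insert p.2 Y) p.1 ∧ NewColumn M (insert p.1 X) Y p.2).card := by
  obtain ⟨N, hN, hNM⟩ := hcov
  obtain ⟨x0, hx0⟩ := hX
  obtain ⟨y0, hy0⟩ := hY
  -- A row that is not new gets its representative in `X`; a new row gets an arbitrary value, as all
  -- its entries count as errors.
  have hφ : ∀ i, ∃ x ∈ X, ¬ NewRow M X Y i → ∀ y ∈ Y, M x y = M i y := by
    intro i
    by_cases hi : NewRow M X Y i
    · exact ⟨x0, hx0, fun h => absurd hi h⟩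
    · have hi' := hi
      unfold NewRow at hi'
      push Not at hi'
      obtain ⟨x, hx, h⟩ := hi'
      exact ⟨x, hx, fun _ => h⟩
  have hψ : ∀ j, ∃ y ∈ Y, ¬ NewColumn M X Y j → ∀ x ∈ X, M x y = M x j := by
    intro j
    by_cases hj : NewColumn M X Y j
    · exact ⟨y0, hy0, fun h => absurd hj h⟩
    · have hj' := hj
      unfold NewColumn at hj'
      push Not at hj'
      obtain ⟨y, hy, h⟩ := hj'
      exact ⟨y, hy, fun _ => h⟩
  choose φ hφX hφ using hφ
  choose ψ hψY hψ using hψ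
  have hlt := hfar _ (hN.comp φ ψ)
  set R := univ.filter (NewRow M X Y)
  set C := univ.filter (NewColumn M X Y)
  set E := univ.filter fun p : Fin n × Fin m =>
      NewRow M X (insert p.2 Y) p.1 ∧ NewColumn M (insert p.1 X) Y p.2
  have hsub : (univ.filter fun p : Fin n × Fin m => M p.1 p.2 ≠ N (φ p.1) (ψ p.2)) ⊆
      (R ×ˢ univ ∪ univ ×ˢ C) ∪ E := by
    rintro ⟨i, j⟩ hij
    simp only [mem_filter, mem_univ, true_and] at hij
    rw [hNM _ (hφX i) _ (hψY j)] at hij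
    by_cases hi : NewRow M X Y i
    · simp [R, hi]
    by_cases hj : NewColumn M X Y j
    · simp [C, hj]
    refine mem_union_right _ ?_
    simp only [E, mem_filter, mem_univ, true_and]
    constructor
    · intro x hx
      -- Only the representative of `i` can agree with it on `Y`, and column `j` tells these two
      -- apart: `M (φ i) j = M (φ i) (ψ j) ≠ M i j`.
      by_cases hxi : ∀ y ∈ Y, M x y = M (φ i) y
      · obtain rfl := hsep.1 x hx _ (hφX i) hxi
        refine ⟨j, mem_insert_self _ _, ?_⟩
        rw [← hψ j hj _ hx]
        exact hij.symm
      · push Not at hxi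
        obtain ⟨y, hy, hne⟩ := hxi
        exact ⟨y, mem_insert_of_mem hy, by rwa [← hφ i hi y hy]⟩
    · intro y hy
      by_cases hyj : ∀ x ∈ X, M x y = M x (ψ j)
      · obtain rfl := hsep.2 y hy _ (hψY j) hyj
        refine ⟨i, mem_insert_self _ _, ?_⟩
        rw [← hφ i hi _ hy]
        exact hij.symm
      · push Not at hyj
        obtain ⟨x, hx, hne⟩ := hyj
        exact ⟨x, mem_insert_of_mem hx, by rwa [← hψ j hj x hx]⟩
  have hcard : numDiff M (fun i j => N (φ i) (ψ j)) ≤ R.card * m + n * C.card + E.card := by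
    refine (card_le_card hsub).trans ((card_union_le _ _).trans ?_)
    refine Nat.add_le_add_right ((card_union_le _ _).trans ?_) _
    simp [card_product]
  have hcard' : (numDiff M (fun i j => N (φ i) (ψ j)) : ℝ) ≤
      R.card * m + n * C.card + E.card := by exact_mod_cast hcard
  by_contra! hcon
  obtain ⟨h1, h2, h3⟩ := hcon
  have a1 : (R.card : ℝ) * m ≤ ε / 3 * n * m := by gcongr
  have a2 : (n : ℝ) * C.card ≤ n * (ε / 3 * m) := by gcongr
  linarith

/-- `M` is certified to be not coverable on some `X' × Y'` that extends `X × Y` by terms of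
sufficiently early blocks. -/
def Reached (s d : ℕ) (M : BMat n m) (B : ℕ) {L p q : ℕ} (X : Finset (Fin n)) (Y : Finset (Fin m))
    (w : (Fin p → Fin L → Fin n) × (Fin q → Fin L → Fin m)) : Prop :=
  ∃ X' Y', X ⊆ X' ∧ Y ⊆ Y' ∧ X'.card * Y'.card ≤ B ∧ ¬ Coverable s d M X' Y' ∧
    (∀ x ∈ X', x ∈ X ∨ ∃ (u : Fin p) (l : Fin L), (u : ℕ) + X.card < X'.card ∧ x = w.1 u l) ∧
    ∀ y ∈ Y', y ∈ Y ∨ ∃ (u : Fin q) (l : Fin L), (u : ℕ) + Y.card < Y'.card ∧ y = w.2 u l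

/-- The sequences of blocks give no certificate as in `Reached`. -/
def Missed (s d : ℕ) (M : BMat n m) (B : ℕ) {L p q : ℕ} (X : Finset (Fin n)) (Y : Finset (Fin m))
    (w : (Fin p → Fin L → Fin n) × (Fin q → Fin L → Fin m)) : Prop :=
  ¬ Reached s d M B X Y w

/-- Prepending a block raises the later indices by one while the starting set is smaller by one
element, so `u + X.card` is unchanged. -/
theorem cons_block_of_insert {k L p : ℕ} {X X' : Finset (Fin k)} {v : Fin L → Fin k} {l : Fin L}
    {f : Fin p → Fin L → Fin k} (hX : insert (v l) X ⊆ X') (hv : v l ∉ X)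
    (h : ∀ x ∈ X', x ∈ insert (v l) X ∨
      ∃ (u : Fin p) (l' : Fin L), (u : ℕ) + (insert (v l) X).card < X'.card ∧ x = f u l') :
    ∀ x ∈ X', x ∈ X ∨ ∃ (u : Fin (p + 1)) (l' : Fin L), (u : ℕ) + X.card < X'.card ∧
      x = (Fin.cons v f : Fin (p + 1) → Fin L → Fin k) u l' := by
  have hc := card_le_card hX
  intro x hx
  rw [card_insert_of_notMem hv] at hc h
  rcases h x hx with h | ⟨u, l', hu, rfl⟩
  · rcases mem_insert.1 h with rfl | h
    · exact Or.inr ⟨0, l, by simpa using hc, rfl⟩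
    · exact Or.inl h
  · exact Or.inr ⟨u.succ, l', by rw [Fin.val_succ]; omega, rfl⟩

theorem Reached.cons_left {M : BMat n m} {B L p q : ℕ} {X : Finset (Fin n)} {Y : Finset (Fin m)}
    {v : Fin L → Fin n} {l : Fin L} {w : (Fin p → Fin L → Fin n) × (Fin q → Fin L → Fin m)}
    (hv : v l ∉ X) (h : Reached s d M B (insert (v l) X) Y w) :
    Reached s d M B X Y (consLeft _ _ p q (v, w)) := by
  obtain ⟨X', Y', hX, hY, hB, hcov, h1, h2⟩ := h
  exact ⟨X', Y', (subset_insert _ _).trans hX, hY, hB, hcov, cons_block_of_insert hX hv h1, h2⟩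

theorem Reached.cons_right {M : BMat n m} {B L p q : ℕ} {X : Finset (Fin n)} {Y : Finset (Fin m)}
    {v : Fin L → Fin m} {l : Fin L} {w : (Fin p → Fin L → Fin n) × (Fin q → Fin L → Fin m)}
    (hv : v l ∉ Y) (h : Reached s d M B X (insert (v l) Y) w) :
    Reached s d M B X Y (consRight _ _ p q (v, w)) := by
  obtain ⟨X', Y', hX, hY, hB, hcov, h1, h2⟩ := h
  exact ⟨X', Y', hX, (subset_insert _ _).trans hY, hB, hcov, h1, cons_block_of_insert hY hv h2⟩

theorem Reached.cons_both {M : BMat n m} {B L p q : ℕ} {X : Finset (Fin n)} {Y : Finset (Fin m)}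
    {v : (Fin L → Fin n) × (Fin L → Fin m)} {l : Fin L}
    {w : (Fin p → Fin L → Fin n) × (Fin q → Fin L → Fin m)}
    (hv : v.1 l ∉ X) (hv' : v.2 l ∉ Y)
    (h : Reached s d M B (insert (v.1 l) X) (insert (v.2 l) Y) w) :
    Reached s d M B X Y (consBoth _ _ p q (v, w)) := by
  obtain ⟨X', Y', hX, hY, hB, hcov, h1, h2⟩ := h
  exact ⟨X', Y', (subset_insert _ _).trans hX, (subset_insert _ _).trans hY, hB, hcov,
    cons_block_of_insert hX hv h1, cons_block_of_insert hY hv' h2⟩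

/-- All but a small fraction of the sequences of blocks certify that a far matrix has large
`s`-binary rank. -/
theorem IsFar.mul_card_not_reached_le {ε : ℝ} {M : BMat n m}
    (hfar : IsFar ε (HasCover s d) M) {K L D : ℕ} (hK : K = chooseLe d s * 2 ^ d)
    (hD : (1 - ε / 3) ^ L * D ≤ 1) :
    ∀ (t p q : ℕ) (X : Finset (Fin n)) (Y : Finset (Fin m)), p + q ≤ t → X.Nonempty → Y.Nonempty →
      Separated M X Y → X.card * Y.card ≤ 4 * K → K + 1 ≤ p + X.card → K + 1 ≤ q + Y.card →
      D * (univ.filter fun w : (Fin p → Fin L → Fin n) × (Fin q → Fin L → Fin m) =>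
        Missed s d M (4 * K) X Y w).card ≤
        t * Fintype.card ((Fin p → Fin L → Fin n) × (Fin q → Fin L → Fin m)) := by
  intro t
  induction t with
  | zero =>
    intro p q X Y hpq hX hY hsep hB hp hq
    -- No blocks are left, so `X` and `Y` have more than `K` elements each.
    have hcov : ¬ Coverable s d M X Y := fun h => by
      have := h.card_mul_card_le hsep
      have := hX.card_pos
      have := hY.card_pos
      nlinarith
    have hempty : (univ.filter fun w : (Fin p → Fin L → Fin n) × (Fin q → Fin L → Fin m) =>
        Missed s d M (4 * K) X Y w) = ∅ := filter_eq_empty_iff.2 fun w _ hw =>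
      hw ⟨X, Y, Subset.rfl, Subset.rfl, hB, hcov, fun _ => Or.inl, fun _ => Or.inl⟩
    simp [hempty]
  | succ t ih =>
    intro p q X Y hpq hX hY hsep hB hp hq
    by_cases hcov : Coverable s d M X Y
    swap
    · have hempty : (univ.filter fun w : (Fin p → Fin L → Fin n) × (Fin q → Fin L → Fin m) =>
          Missed s d M (4 * K) X Y w) = ∅ := filter_eq_empty_iff.2 fun w _ hw =>
        hw ⟨X, Y, Subset.rfl, Subset.rfl, hB, hcov, fun _ => Or.inl, fun _ => Or.inl⟩
      simp [hempty]
    have hXY := hcov.card_mul_card_le hsep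
    rw [← hK] at hXY
    have hX1 := hX.card_pos
    have hY1 := hY.card_pos
    have hXK : X.card ≤ K := (Nat.le_mul_of_pos_right _ hY1).trans hXY
    have hYK : Y.card ≤ K := (Nat.le_mul_of_pos_left _ hX1).trans hXY
    -- Coverability keeps both cardinalities at most `K`, so a fresh block of each kind remains.
    obtain ⟨p, rfl⟩ : ∃ p', p = p' + 1 := Nat.exists_eq_succ_of_ne_zero (by omega)
    obtain ⟨q, rfl⟩ : ∃ q', q = q' + 1 := Nat.exists_eq_succ_of_ne_zero (by omega)
    rcases hfar.expansion hX hY hsep hcov with h | h | h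
    · refine mul_card_filter_le_of_equiv (consLeft _ _ p (q + 1)) _
        (fun v => ∀ l, v l ∉ univ.filter (NewRow M X Y))
        (mul_card_miss_le hD _ (by rwa [Fintype.card_fin]) _ fun _ => id) fun v hv => ?_
      push Not at hv
      obtain ⟨l, hl⟩ := hv
      have hl := (mem_filter.1 hl).2
      have hc := card_insert_of_notMem hl.notMem
      refine le_trans (Nat.mul_le_mul_left D (card_le_card ?_))
        (ih p (q + 1) (insert (v l) X) Y (by omega) (insert_nonempty _ _) hY
          (hsep.insert_row hl) (by rw [hc]; nlinarith) (by omega) hq)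
      exact monotone_filter_right _ fun w _ hw hr => hw (hr.cons_left hl.notMem)
    · refine mul_card_filter_le_of_equiv (consRight _ _ (p + 1) q) _
        (fun v => ∀ l, v l ∉ univ.filter (NewColumn M X Y))
        (mul_card_miss_le hD _ (by rwa [Fintype.card_fin]) _ fun _ => id) fun v hv => ?_
      push Not at hv
      obtain ⟨l, hl⟩ := hv
      have hl := (mem_filter.1 hl).2
      have hc := card_insert_of_notMem hl.notMem
      refine le_trans (Nat.mul_le_mul_left D (card_le_card ?_))
        (ih (p + 1) q X (insert (v l) Y) (by omega) hX (insert_nonempty _ _)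
          (hsep.insert_column hl) (by rw [hc]; nlinarith) hp (by omega))
      exact monotone_filter_right _ fun w _ hw hr => hw (hr.cons_right hl.notMem)
    · refine mul_card_filter_le_of_equiv (consBoth _ _ p q) _
        (fun v : (Fin L → Fin n) × (Fin L → Fin m) => ∀ l,
          (v.1 l, v.2 l) ∉ univ.filter fun p : Fin n × Fin m =>
            NewRow M X (insert p.2 Y) p.1 ∧ NewColumn M (insert p.1 X) Y p.2)
        (mul_card_pair_miss_le hD _ (by
          rw [Fintype.card_prod, Fintype.card_fin, Fintype.card_fin]
          push_cast
          exact h) _ fun _ => id) fun v hv => ?_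
      push Not at hv
      obtain ⟨l, hl⟩ := hv
      obtain ⟨hl, hl'⟩ := (mem_filter.1 hl).2
      dsimp only at hl hl'
      have hc := card_insert_of_notMem hl.notMem
      have hc' := card_insert_of_notMem hl'.notMem
      -- This case is where `4 * K` comes from: `(X.card + 1) * (Y.card + 1) ≤ 4 * (X.card *
      -- Y.card)` for nonempty sets.
      refine le_trans (Nat.mul_le_mul_left D (card_le_card ?_))
        (ih p q (insert (v.1 l) X) (insert (v.2 l) Y) (by omega) (insert_nonempty _ _)
          (insert_nonempty _ _) (hsep.insert_both hl hl') (by rw [hc, hc']; nlinarith)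
          (by omega) (by omega))
      exact monotone_filter_right _ fun w _ hw hr => hw (hr.cons_both hl.notMem hl'.notMem)

end Expansion
-- From certificates to testers
section Testers
open Classical
variable {n m s d : ℕ}

/-- A tester that draws a uniform element of `Ω`, queries the entries
`pos ω q` for all `q : ι`, and accepts if the answers are consistent with `P`. -/
theorem exists_tester_of_consistency {Ω ι : Type} [Fintype Ω] [Nonempty Ω] [Fintype ι] {ε : ℝ}
    {P : BMat n m → Prop} (pos : Ω → ι → Fin n × Fin m)
    (h : ∀ M, IsFar ε P M → 3 * (univ.filter fun ω : Ω => ∃ N : BMat n m, P N ∧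
      ∀ q, N (pos ω q).1 (pos ω q).2 = M (pos ω q).1 (pos ω q).2).card ≤ Fintype.card Ω) :
    ∃ A : NonadaptiveAlgorithm n m, A.IsOneSidedTester ε P ∧ A.numQueries = Fintype.card ι := by
  let e : Fin (Fintype.card ι) ≃ ι := (Fintype.equivFin ι).symm
  let A : NonadaptiveAlgorithm n m :=
    { Coins := Ω
      law := PMF.uniformOfFintype Ω
      numQueries := Fintype.card ι
      query := fun ω q => pos ω (e q)
      decision := fun ω ans => decide (∃ N : BMat n m, P N ∧
        ∀ q, N (pos ω (e q)).1 (pos ω (e q)).2 = ans q) }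
  refine ⟨A, ⟨fun M hM => ?_, fun M hM => ?_⟩, rfl⟩
  · have hconst : (fun r => A.decision r fun q => M (A.query r q).1 (A.query r q).2) =
        Function.const Ω true := by
      funext ω
      simp only [A, Function.const_apply, decide_eq_true_eq]
      exact ⟨M, hM, fun _ => rfl⟩
    rw [NonadaptiveAlgorithm.output, hconst, PMF.map_const]
    simp
  · set c : Ω → Prop := fun ω => ∃ N : BMat n m, P N ∧
      ∀ q, N (pos ω q).1 (pos ω q).2 = M (pos ω q).1 (pos ω q).2 with hc
    have hdec : ∀ ω, (A.decision ω fun q => M (A.query ω q).1 (A.query ω q).2) = decide (c ω) := by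
      intro ω
      simp only [A, hc, decide_eq_decide]
      refine exists_congr fun N => and_congr_right fun _ => ?_
      exact e.forall_congr_left (p := fun q =>
        N (pos ω (e q)).1 (pos ω (e q)).2 = M (pos ω (e q)).1 (pos ω (e q)).2) |>.trans (by simp)
    have hout : A.output M false = ((univ.filter fun ω => ¬ c ω).card : ENNReal) /
        Fintype.card Ω := by
      rw [NonadaptiveAlgorithm.output, PMF.map_apply, tsum_fintype]
      rw [div_eq_mul_inv, ← nsmul_eq_mul, ← sum_const, sum_filter]
      refine Finset.sum_congr rfl fun ω _ => ?_
      rw [hdec]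
      by_cases h : c ω <;> simp [h, A]
    have hcard : 2 * Fintype.card Ω ≤ 3 * (univ.filter fun ω => ¬ c ω).card := by
      have h1 : 3 * (univ.filter c).card ≤ Fintype.card Ω := h M hM
      have h2 := card_filter_add_card_filter_not (s := (univ : Finset Ω)) c
      rw [card_univ] at h2
      omega
    rw [hout, ENNReal.le_div_iff_mul_le (by simp) (by simp), ← ENNReal.mul_div_right_comm]
    refine ENNReal.div_le_of_le_mul ?_
    rw [mul_comm _ (3 : ENNReal)]
    exact_mod_cast hcard

theorem exists_tester_of_forall_not {ε : ℝ} {P : BMat n m → Prop} (h : ∀ M, ¬ P M) :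
    ∃ A : NonadaptiveAlgorithm n m, A.IsOneSidedTester ε P ∧ A.numQueries = 0 := by
  refine exists_tester_of_consistency (Ω := Unit) (ι := Empty) (fun _ q => q.elim) fun M _ => ?_
  simp [h]

theorem exists_tester_all_queries {ε : ℝ} (hε : 0 ≤ ε) (P : BMat n m → Prop) :
    ∃ A : NonadaptiveAlgorithm n m, A.IsOneSidedTester ε P ∧ A.numQueries = n * m := by
  have := exists_tester_of_consistency (Ω := Unit) (ι := Fin n × Fin m) (ε := ε) (P := P)
    (fun _ q => q) fun M hM => by
      have : ∀ N : BMat n m, P N → ¬ ∀ q : Fin n × Fin m, N q.1 q.2 = M q.1 q.2 := by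
        intro N hN hNM
        have h := hM N hN
        have h0 : numDiff M N = 0 := by
          rw [numDiff, card_eq_zero, filter_eq_empty_iff]
          exact fun p _ hp => hp (hNM p).symm
        rw [h0, Nat.cast_zero] at h
        exact absurd h (not_lt.2 (by positivity))
      rw [filter_eq_empty_iff.2 fun _ _ ⟨N, hN, h⟩ => this N hN h]
      simp
  simpa using this

/-- The pairs of blocks below the hyperbola. -/
abbrev HyperbolaPairs (B : ℕ) : Type :=
  {p : Fin B × Fin B // ((p.1 : ℕ) + 1) * ((p.2 : ℕ) + 1) ≤ B}

/-- Row index `u` admits at most `B / (u + 1)` column indices, and these bounds form a harmonic sum.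
-/
theorem card_hyperbolaPairs_le (B : ℕ) :
    (Fintype.card (HyperbolaPairs B) : ℝ) ≤ B * (1 + Real.log B) := by
  have hfib : ∀ u : Fin B, (univ.filter fun w : Fin B => ((u : ℕ) + 1) * ((w : ℕ) + 1) ≤ B).card ≤
      B / ((u : ℕ) + 1) := by
    intro u
    have : ((univ.filter fun w : Fin B => ((u : ℕ) + 1) * ((w : ℕ) + 1) ≤ B).map
        Fin.valEmbedding) ⊆ range (B / ((u : ℕ) + 1)) := by
      intro x hx
      simp only [mem_map, mem_filter, mem_univ, true_and, Fin.valEmbedding_apply] at hx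
      obtain ⟨w, hw, rfl⟩ := hx
      rw [mem_range, ← Nat.succ_le_iff, Nat.le_div_iff_mul_le (Nat.succ_pos _), mul_comm]
      exact hw
    simpa using card_le_card this
  have hcard : Fintype.card (HyperbolaPairs B) =
      ∑ u : Fin B, (univ.filter fun w : Fin B => ((u : ℕ) + 1) * ((w : ℕ) + 1) ≤ B).card := by
    rw [Fintype.card_subtype]
    simp only [card_filter]
    rw [Fintype.sum_prod_type]
  calc (Fintype.card (HyperbolaPairs B) : ℝ)
      ≤ ∑ u : Fin B, (B : ℝ) * (((u : ℕ) : ℝ) + 1)⁻¹ := by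
        rw [hcard, Nat.cast_sum]
        refine sum_le_sum fun u _ => ?_
        refine (Nat.cast_le.2 (hfib u)).trans (Nat.cast_div_le.trans ?_)
        rw [div_eq_mul_inv]
        push_cast
        exact le_rfl
    _ = B * (harmonic B : ℝ) := by
        rw [← mul_sum, Fin.sum_univ_eq_sum_range (fun u => ((u : ℝ) + 1)⁻¹), harmonic]
        push_cast
        rfl
    _ ≤ B * (1 + Real.log B) := by
        gcongr
        exact harmonic_le_one_add_log B

/-- The `l`-th entry of the `u`-th block, where the block `0` is constant. -/
def blockEntry {k K L : ℕ} (a : Fin k) (f : Fin K → Fin L → Fin k) (u : ℕ) (l : Fin L) : Fin k :=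
  -- Indices run up to `4 * K` although there are only `K` random blocks; superfluous indices return
  -- the constant `a`.
  if h : 0 < u ∧ u - 1 < K then f ⟨u - 1, h.2⟩ l else a

theorem exists_blockEntry {k K L : ℕ} {a : Fin k} {f : Fin K → Fin L → Fin k} (hL : 0 < L)
    {X : Finset (Fin k)} (h : ∀ x ∈ X, x ∈ ({a} : Finset (Fin k)) ∨
      ∃ (u : Fin K) (l : Fin L), (u : ℕ) + ({a} : Finset (Fin k)).card < X.card ∧ x = f u l) :
    ∀ x ∈ X, ∃ u l, u < X.card ∧ blockEntry a f u l = x := by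
  intro x hx
  rcases h x hx with h | ⟨u, l, hu, rfl⟩
  · refine ⟨0, ⟨0, hL⟩, card_pos.2 ⟨x, hx⟩, ?_⟩
    simp [blockEntry, mem_singleton.1 h]
  · rw [card_singleton] at hu
    refine ⟨u + 1, l, hu, ?_⟩
    simp [blockEntry]

/-- The tester for `s`-binary rank at most `d`, for a given block length. -/
theorem exists_rank_le_tester (hn : 0 < n) (hm : 0 < m) {ε : ℝ} {K L : ℕ}
    (hK : K = chooseLe d s * 2 ^ d) (hK1 : 0 < K) (hL : 0 < L)
    (hD : (1 - ε / 3) ^ L * (6 * K : ℕ) ≤ 1) :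
    ∃ A : NonadaptiveAlgorithm n m, A.IsOneSidedTester ε (HasCover s d) ∧
      A.numQueries = Fintype.card (HyperbolaPairs (4 * K)) * (L * L) := by
  let a : Fin n := ⟨0, hn⟩
  let b : Fin m := ⟨0, hm⟩
  have : Nonempty ((Fin K → Fin L → Fin n) × (Fin K → Fin L → Fin m)) :=
    ⟨(fun _ _ => a, fun _ _ => b)⟩
  have := exists_tester_of_consistency (n := n) (m := m) (ε := ε) (P := HasCover s d)
    (Ω := (Fin K → Fin L → Fin n) × (Fin K → Fin L → Fin m))
    (ι := HyperbolaPairs (4 * K) × (Fin L × Fin L))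
    (fun ω q => (blockEntry a ω.1 q.1.1.1 q.2.1, blockEntry b ω.2 q.1.1.2 q.2.2)) ?_
  · simpa using this
  intro M hM
  -- The failure probability is at most `2 * K` blocks times `1 / (6 * K)`, that is `1/3`. Starting
  -- from singletons, `K` blocks on each side suffice to reach cardinality `K + 1`.
  have hmiss := hM.mul_card_not_reached_le hK hD (2 * K) K K {a} {b} (by omega)
    (singleton_nonempty _) (singleton_nonempty _) (by simp [Separated]) (by simp; omega)
    (by simp) (by simp)
  have hsub : (univ.filter fun ω : (Fin K → Fin L → Fin n) × (Fin K → Fin L → Fin m) =>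
      ∃ N : BMat n m, HasCover s d N ∧ ∀ q : HyperbolaPairs (4 * K) × (Fin L × Fin L),
        N (blockEntry a ω.1 q.1.1.1 q.2.1) (blockEntry b ω.2 q.1.1.2 q.2.2) =
        M (blockEntry a ω.1 q.1.1.1 q.2.1) (blockEntry b ω.2 q.1.1.2 q.2.2)) ⊆
      univ.filter fun w : (Fin K → Fin L → Fin n) × (Fin K → Fin L → Fin m) =>
        Missed s d M (4 * K) {a} {b} w := by
    refine monotone_filter_right _ fun ω _ => ?_
    rintro ⟨N, hN, hNM⟩ ⟨X, Y, -, -, hB, hcov, h1, h2⟩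
    refine hcov ⟨N, hN, fun x hx y hy => ?_⟩
    obtain ⟨u, l, hu, rfl⟩ := exists_blockEntry hL h1 x hx
    obtain ⟨w, l', hw, rfl⟩ := exists_blockEntry hL h2 y hy
    -- Each entry of the certificate lies in a queried pair of blocks, since `u < X.card` and `w <
    -- Y.card`.
    have huw : (u + 1) * (w + 1) ≤ 4 * K := (Nat.mul_le_mul hu hw).trans hB
    have hu' : u < 4 * K := (Nat.le_mul_of_pos_right _ (Nat.succ_pos w)).trans huw
    have hw' : w < 4 * K := (Nat.le_mul_of_pos_left _ (Nat.succ_pos u)).trans huw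
    exact hNM ⟨⟨(⟨u, hu'⟩, ⟨w, hw'⟩), huw⟩, (l, l')⟩
  have hcard := card_le_card hsub
  refine Nat.le_of_mul_le_mul_left ?_ (show 0 < 2 * K by omega)
  calc _ = 6 * K * _ := by ring
    _ ≤ 6 * K * _ := Nat.mul_le_mul_left _ hcard
    _ ≤ _ := hmiss

end Testers

/-! ### Estimates for the number of queries -/

section QueryBounds

theorem one_le_chooseLe (d s : ℕ) : 1 ≤ chooseLe d s := by
  rw [chooseLe, sum_range_succ']
  simp

theorem sq_le_two_mul_two_pow (d : ℕ) : d ^ 2 ≤ 2 * 2 ^ d := by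
  rcases Nat.lt_or_ge d 4 with h | h
  · interval_cases d <;> norm_num
  · induction d, h using Nat.le_induction with
    | base => norm_num
    | succ k hk ih =>
      rw [pow_succ 2 k]
      nlinarith

/-- A block length that makes the failure probability of a block at most `1 / (6 K)`. -/
theorem exists_block_length {K : ℕ} (hK : 0 < K) {ε : ℝ} (h0 : 0 < ε) (h1 : ε < 1) :
    ∃ L : ℕ, 0 < L ∧ (1 - ε / 3) ^ L * (6 * K : ℕ) ≤ 1 ∧ (L : ℝ) ≤ 4 * Real.log (6 * K) / ε := by
  have hK1 : (1 : ℝ) ≤ K := by exact_mod_cast hK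
  have hlog : 1 ≤ Real.log (6 * K) := by
    rw [Real.le_log_iff_exp_le (by positivity)]
    have := Real.exp_one_lt_d9
    linarith
  have hx : 0 < 3 * Real.log (6 * K) / ε := by positivity
  refine ⟨⌈3 * Real.log (6 * K) / ε⌉₊, Nat.ceil_pos.2 hx, ?_, ?_⟩
  · have hL := Nat.le_ceil (3 * Real.log (6 * K) / ε)
    set L := ⌈3 * Real.log (6 * K) / ε⌉₊
    have hpow : (1 - ε / 3) ^ L ≤ Real.exp (-Real.log (6 * K)) := by
      calc (1 - ε / 3) ^ L ≤ Real.exp (-(ε / 3)) ^ L :=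
            pow_le_pow_left₀ (by linarith) (Real.one_sub_le_exp_neg _) _
        _ = Real.exp (L * -(ε / 3)) := (Real.exp_nat_mul _ _).symm
        _ ≤ _ := Real.exp_le_exp.2 (by
            rw [div_le_iff₀ h0] at hL
            linarith)
    rw [Real.exp_neg, Real.exp_log (by positivity)] at hpow
    push_cast
    calc (1 - ε / 3) ^ L * (6 * K) ≤ (6 * K : ℝ)⁻¹ * (6 * K) := by gcongr
      _ = 1 := inv_mul_cancel₀ (by positivity)
  -- The fourth `log (6 * K) / ε` absorbs the rounding, being at least `1`.
  · have := Nat.ceil_lt_add_one hx.le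
    have h2 : 1 ≤ Real.log (6 * K) / ε := by
      rw [le_div_iff₀ h0]
      linarith
    have h3 : 4 * Real.log (6 * K) / ε = 3 * Real.log (6 * K) / ε + Real.log (6 * K) / ε := by ring
    linarith

/-- The number of queries in terms of `F = K / ε ^ 2`. -/
theorem mul_log_bound {K : ℕ} (hK : 0 < K) {ε : ℝ} (h0 : 0 < ε) (h1 : ε < 1) {H L : ℕ}
    (hH : (H : ℝ) ≤ (4 * K : ℕ) * (1 + Real.log (4 * K : ℕ)))
    (hL : (L : ℝ) ≤ 4 * Real.log (6 * K) / ε) :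
    ((H * (L * L) : ℕ) : ℝ) ≤ 768 * (K / ε ^ 2) * (1 + Real.log (K / ε ^ 2)) ^ 3 := by
  have hK1 : (1 : ℝ) ≤ K := by exact_mod_cast hK
  have hF : (K : ℝ) ≤ K / ε ^ 2 := by
    rw [le_div_iff₀ (by positivity)]
    have : ε ^ 2 ≤ 1 := by nlinarith
    nlinarith
  have hlogF := Real.log_le_log (by positivity) hF
  have hlogK := Real.log_nonneg hK1
  have he := Real.exp_one_gt_d9
  have h6 : Real.log (6 * K) ≤ 2 * (1 + Real.log (K / ε ^ 2)) := by
    rw [Real.log_mul (by norm_num) (by positivity)]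
    have : Real.log 6 ≤ 2 := by
      rw [Real.log_le_iff_le_exp (by norm_num), show (2 : ℝ) = 1 + 1 by norm_num, Real.exp_add]
      nlinarith
    linarith
  have h4 : 1 + Real.log (4 * K : ℕ) ≤ 3 * (1 + Real.log (K / ε ^ 2)) := by
    push_cast
    rw [Real.log_mul (by norm_num) (by positivity)]
    have : Real.log 4 ≤ 2 := by
      rw [Real.log_le_iff_le_exp (by norm_num), show (2 : ℝ) = 1 + 1 by norm_num, Real.exp_add]
      nlinarith
    linarith
  set x := 1 + Real.log (K / ε ^ 2)
  have hx : 0 ≤ x := by simp only [x]; linarith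
  have hL' : (L : ℝ) ≤ 8 * x / ε := hL.trans (by gcongr ?_ / ε; linarith)
  push_cast at hH ⊢
  -- The constant is `768 = 4 * 3 * 8 * 8`.
  calc (H : ℝ) * (L * L) ≤ (4 * K * (3 * x)) * ((8 * x / ε) * (8 * x / ε)) := by
        gcongr
        exact hH.trans (by gcongr; exact_mod_cast h4)
    _ = 768 * (K / ε ^ 2) * x ^ 3 := by
        field_simp
        ring

end QueryBounds
-- Passing from rank at most `d` to rank exactly `d`
section ExactRank
variable {n m s d : ℕ}

theorem numDiff_triangle (M N N' : BMat n m) : numDiff M N' ≤ numDiff M N + numDiff N N' := by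
  classical
  refine (card_le_card fun p hp => ?_).trans (card_union_le _ _)
  simp only [mem_filter, mem_univ, true_and, mem_union] at hp ⊢
  by_contra! h
  exact hp (h.1.trans h.2)

theorem IsFar.of_close {ε : ℝ} {P Q : BMat n m → Prop} {M : BMat n m} (h : IsFar ε P M)
    (hPQ : ∀ N, Q N → ∃ N', P N' ∧ (numDiff N N' : ℝ) ≤ ε / 2 * (n * m)) : IsFar (ε / 2) Q M := by
  intro N hN
  obtain ⟨N', hN', hle⟩ := hPQ N hN
  have h1 := h N' hN'
  have h2 : (numDiff M N' : ℝ) ≤ numDiff M N + numDiff N N' := by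
    exact_mod_cast numDiff_triangle M N N'
  linarith

/-- A matrix of `s`-binary rank at most `d` becomes one of rank exactly `d` after a change of the
rows in `A` and the columns in `B`, provided that these contain a `d × d` block. -/
theorem HasCover.exists_binaryRank_eq (hs : 1 ≤ s) {N : BMat n m} (h : HasCover s d N)
    (hn : d ≤ n) (hm : d ≤ m) (A : Finset (Fin n)) (B : Finset (Fin m))
    (hAB : ∀ (i : Fin n) (j : Fin m), (i : ℕ) < d → (j : ℕ) < d → i ∈ A ∨ j ∈ B) :
    ∃ N' : BMat n m, binaryRank s N' = d ∧ numDiff N N' ≤ A.card * m + n * B.card := by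
  classical
  let p : Fin n → Fin m → Bool := fun i j => decide (i ∉ A ∧ j ∉ B)
  have hp : ∀ i j, p i j = true ↔ i ∉ A ∧ j ∉ B := fun i j => decide_eq_true_iff
  have hp0 : ∀ (i : Fin n) (j : Fin m), (i : ℕ) < d → (j : ℕ) < d → p i j = false := by
    intro i j hi hj
    rw [Bool.eq_false_iff, Ne, hp]
    rintro ⟨hA, hB⟩
    exact (hAB i j hi hj).elim hA hB
  -- Clear the rows in `A` and the columns in `B`, then set the first `t` diagonal entries to `1`.
  -- At `t = d` an identity block, hence a fooling set of size `d`, is present.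
  let F : ℕ → BMat n m := fun t i j => (N i j && p i j) || decide ((i : ℕ) = j ∧ (i : ℕ) < t)
  have hF0 : HasCover s d (F 0) := by
    simpa [F] using h.restrict p A B hp
  have hstep : ∀ t < d, ∀ r, HasCover s r (F t) → HasCover s (r + 1) (F (t + 1)) := by
    intro t ht r hr
    refine hr.succ_of_single hs ⟨t, by omega⟩ ⟨t, by omega⟩ ?_ fun i j => ?_
    · simp [F, hp0 ⟨t, by omega⟩ ⟨t, by omega⟩ ht ht]
    · simp only [F, Bool.or_eq_true, decide_eq_true_eq, Fin.ext_iff, or_assoc]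
      refine or_congr_right ?_
      omega
  have hFd : d ≤ binaryRank s (F d) := by
    refine (hasCover_binaryRank hs (F d)).le_of_fooling (Fin.castLE hn) (Fin.castLE hm) ?_ ?_
    · intro t
      simp [F]
    · intro t u htu
      left
      have : ¬ (t : ℕ) = u := fun h => htu (Fin.ext h)
      simp [F, hp0 (Fin.castLE hn t) (Fin.castLE hm u) t.2 u.2, this]
  -- The rank starts at most `d`, ends at least `d` and rises by at most one per step, so it equals
  -- `d` when it first reaches `d`.
  obtain ⟨τ, hτ, hmin, hτd⟩ : ∃ τ, d ≤ binaryRank s (F τ) ∧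
      (∀ t < τ, ¬ d ≤ binaryRank s (F t)) ∧ τ ≤ d :=
    have hex : ∃ t, d ≤ binaryRank s (F t) := ⟨d, hFd⟩
    ⟨Nat.find hex, Nat.find_spec hex, fun _ => Nat.find_min hex, Nat.find_min' hex hFd⟩
  refine ⟨F τ, le_antisymm ?_ hτ, ?_⟩
  · rw [binaryRank_le_iff hs]
    rcases τ with _ | t
    · exact hF0
    · have hlt := hmin t (Nat.lt_succ_self t)
      exact (hstep _ (by omega) _ (hasCover_binaryRank hs _)).mono (by omega)
  · have hsub : (univ.filter fun q : Fin n × Fin m => N q.1 q.2 ≠ F τ q.1 q.2) ⊆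
        A ×ˢ univ ∪ univ ×ˢ B := by
      rintro ⟨i, j⟩ hij
      by_contra hcon
      simp only [mem_union, mem_product, mem_univ, and_true, true_and, not_or] at hcon
      have h1 : ¬ ((i : ℕ) = j ∧ (i : ℕ) < τ) := fun h =>
        (hAB i j (by omega) (by omega)).elim hcon.1 hcon.2
      simp [F, (hp i j).2 hcon, h1] at hij
    refine (card_le_card hsub).trans ((card_union_le _ _).trans ?_)
    simp [card_product]

theorem card_filter_val_lt (n d : ℕ) :
    (univ.filter fun i : Fin n => (i : ℕ) < d).card ≤ d := by
  have : ((univ.filter fun i : Fin n => (i : ℕ) < d).map Fin.valEmbedding) ⊆ range d := by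
    intro x hx
    simp only [mem_map, mem_filter, mem_univ, true_and, Fin.valEmbedding_apply] at hx
    obtain ⟨w, hw, rfl⟩ := hx
    exact mem_range.2 hw
  simpa using card_le_card this

/-- In a matrix that is long compared to `d`, rank at most `d` is close to rank exactly `d`. -/
theorem HasCover.exists_binaryRank_eq_close (hs : 1 ≤ s) {N : BMat n m} (h : HasCover s d N)
    (hn : d ≤ n) (hm : d ≤ m) {δ : ℝ} (hδ : (d : ℝ) ≤ δ * n ∨ (d : ℝ) ≤ δ * m) :
    ∃ N' : BMat n m, binaryRank s N' = d ∧ (numDiff N N' : ℝ) ≤ δ * (n * m) := by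
  rcases hδ with hδ | hδ
  · obtain ⟨N', hN', hle⟩ := h.exists_binaryRank_eq hs hn hm
      (univ.filter fun i => (i : ℕ) < d) ∅ (fun i j hi _ => Or.inl (by simpa using hi))
    refine ⟨N', hN', ?_⟩
    have hle' : numDiff N N' ≤ d * m :=
      hle.trans (by simpa using Nat.mul_le_mul_right m (card_filter_val_lt n d))
    calc (numDiff N N' : ℝ) ≤ d * m := by exact_mod_cast hle'
      _ ≤ δ * n * m := by gcongr
      _ = _ := by ring
  · obtain ⟨N', hN', hle⟩ := h.exists_binaryRank_eq hs hn hm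
      ∅ (univ.filter fun j => (j : ℕ) < d) (fun i j _ hj => Or.inr (by simpa using hj))
    refine ⟨N', hN', ?_⟩
    have hle' : numDiff N N' ≤ n * d :=
      hle.trans (by simpa using Nat.mul_le_mul_left n (card_filter_val_lt m d))
    calc (numDiff N N' : ℝ) ≤ n * d := by exact_mod_cast hle'
      _ ≤ n * (δ * m) := by gcongr
      _ = _ := by ring

end ExactRank

/-! ### The two testers with explicit bounds -/

section Main
variable {n m s d : ℕ}

theorem one_le_queryScale (s d : ℕ) {ε : ℝ} (h0 : 0 < ε) (h1 : ε < 1) :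
    1 ≤ queryScale s d ε := by
  rw [queryScale, le_div_iff₀ (by positivity)]
  have a : (1 : ℝ) ≤ chooseLe d s := by exact_mod_cast one_le_chooseLe d s
  have b : (1 : ℝ) ≤ 2 ^ d := one_le_pow₀ (by norm_num)
  nlinarith

theorem exists_rank_le_tester_queryScale {ε : ℝ} (h0 : 0 < ε) (h1 : ε < 1) (hs : 1 ≤ s)
    (n m : ℕ) :
    ∃ A : NonadaptiveAlgorithm n m, A.IsOneSidedTester ε (fun M => binaryRank s M ≤ d) ∧
      (A.numQueries : ℝ) ≤
        768 * queryScale s d ε * (1 + Real.log (queryScale s d ε)) ^ 3 := by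
  have hF := one_le_queryScale s d h0 h1
  have hlog := Real.log_nonneg hF
  -- An empty matrix has no row or column to start the growth from, but reading it all costs
  -- nothing.
  rcases Nat.eq_zero_or_pos (n * m) with hnm | hnm
  · obtain ⟨A, hA, hq⟩ := exists_tester_all_queries (n := n) (m := m) h0.le
      (fun M => binaryRank s M ≤ d)
    refine ⟨A, hA, ?_⟩
    rw [hq, hnm, Nat.cast_zero]
    positivity
  have hK : 0 < chooseLe d s * 2 ^ d := Nat.mul_pos (one_le_chooseLe d s) (by positivity)
  obtain ⟨L, hL, hD, hL'⟩ := exists_block_length hK h0 h1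
  obtain ⟨A, hA, hq⟩ := exists_rank_le_tester (Nat.pos_of_mul_pos_right hnm)
    (Nat.pos_of_mul_pos_left hnm) rfl hK hL hD
  refine ⟨A, ?_, ?_⟩
  · simpa only [binaryRank_le_iff hs] using hA
  · rw [hq]
    have := mul_log_bound hK h0 h1 (card_hyperbolaPairs_le _) hL'
    rw [queryScale]
    push_cast at this ⊢
    exact this

theorem exists_rank_eq_tester_queryScale {ε : ℝ} (h0 : 0 < ε) (h1 : ε < 1) (hs : 1 ≤ s)
    (n m : ℕ) :
    ∃ A : NonadaptiveAlgorithm n m, A.IsOneSidedTester ε (fun M => binaryRank s M = d) ∧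
      (A.numQueries : ℝ) ≤
        82944 * queryScale s d ε * (1 + Real.log (queryScale s d ε)) ^ 3 := by
  have hF := one_le_queryScale s d h0 h1
  have hlog := Real.log_nonneg hF
  by_cases hex : ∃ M : BMat n m, binaryRank s M = d
  swap
  · obtain ⟨A, hA, hq⟩ := exists_tester_of_forall_not (ε := ε) (not_exists.1 hex)
    refine ⟨A, hA, ?_⟩
    rw [hq, Nat.cast_zero]
    positivity
  obtain ⟨M, rfl⟩ := hex
  set d := binaryRank s M
  have hn : d ≤ n := (binaryRank_le_iff hs).2 (HasCover.rows hs M)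
  have hm : d ≤ m := (binaryRank_le_iff hs).2 (HasCover.columns hs M)
  by_cases hlong : (d : ℝ) ≤ ε / 2 * n ∨ (d : ℝ) ≤ ε / 2 * m
  · obtain ⟨A, ⟨hA1, hA2⟩, hq⟩ := exists_rank_le_tester_queryScale (s := s) (d := d)
      (half_pos h0) (by linarith : ε / 2 < 1) hs n m
    refine ⟨A, ⟨fun N hN => hA1 N hN.le, fun N hN => hA2 N (hN.of_close fun N' hN' => ?_)⟩, ?_⟩
    · exact ((binaryRank_le_iff hs).1 hN').exists_binaryRank_eq_close hs hn hm hlong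
    · have hscale : queryScale s d (ε / 2) = 4 * queryScale s d ε := by
        rw [queryScale, queryScale]
        field_simp
        ring
      refine hq.trans ?_
      rw [hscale, Real.log_mul (by norm_num) (by positivity)]
      have h4 : Real.log 4 ≤ 2 := by
        have he := Real.exp_one_gt_d9
        rw [Real.log_le_iff_le_exp (by norm_num), show (2 : ℝ) = 1 + 1 by norm_num, Real.exp_add]
        nlinarith
      have h4' : 0 ≤ Real.log 4 := Real.log_nonneg (by norm_num)
      set F := queryScale s d ε
      -- Halving `ε` multiplies the scale by `4`, and `log 4 ≤ 2` costs a factor `3` in the base of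
      -- the cube: `82944 = 768 * 4 * 27`.
      calc 768 * (4 * F) * (1 + (Real.log 4 + Real.log F)) ^ 3
          ≤ 768 * (4 * F) * (3 * (1 + Real.log F)) ^ 3 := by
            gcongr
            linarith
        _ = 82944 * F * (1 + Real.log F) ^ 3 := by ring
  · push Not at hlong
    obtain ⟨A, hA, hq⟩ := exists_tester_all_queries (n := n) (m := m) h0.le
      (fun M => binaryRank s M = d)
    refine ⟨A, hA, ?_⟩
    -- Both sides are now shorter than `2 * d / ε`, so there are at most `4 * d ^ 2 / ε ^ 2`
    -- entries, and `d ^ 2 ≤ 2 * 2 ^ d` brings this within the scale.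
    have hn' : (n : ℝ) ≤ 2 * d / ε := by
      rw [le_div_iff₀ h0]
      linarith [hlong.1]
    have hm' : (m : ℝ) ≤ 2 * d / ε := by
      rw [le_div_iff₀ h0]
      linarith [hlong.2]
    have hd : (d : ℝ) ^ 2 ≤ 2 * 2 ^ d := by exact_mod_cast sq_le_two_mul_two_pow d
    have hc : (1 : ℝ) ≤ chooseLe d s := by exact_mod_cast one_le_chooseLe d s
    rw [hq]
    push_cast
    calc (n : ℝ) * m ≤ (2 * d / ε) * (2 * d / ε) := by gcongr
      _ = 4 * (1 * (d : ℝ) ^ 2) / ε ^ 2 := by ring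
      _ ≤ 4 * (chooseLe d s * (2 * 2 ^ d)) / ε ^ 2 := by gcongr
      _ = 8 * queryScale s d ε * 1 := by rw [queryScale]; ring
      _ ≤ 82944 * queryScale s d ε * (1 + Real.log (queryScale s d ε)) ^ 3 := by
          gcongr
          · norm_num
          · exact one_le_pow₀ (by linarith)

end Main
end RankTesting

theorem theorem2 :
    ∃ (C : ℝ) (c : ℕ), ∀ (s d n m : ℕ) (ε : ℝ), 1 ≤ s → 0 < ε → ε < 1 →
      (∃ A : RankTesting.NonadaptiveAlgorithm n m,
        A.IsOneSidedTester ε (fun M => RankTesting.binaryRank s M ≤ d) ∧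
        (A.numQueries : ℝ) ≤ C * RankTesting.queryScale s d ε *
          (1 + Real.log (RankTesting.queryScale s d ε)) ^ c) ∧
      (∃ A : RankTesting.NonadaptiveAlgorithm n m,
        A.IsOneSidedTester ε (fun M => RankTesting.binaryRank s M = d) ∧
        (A.numQueries : ℝ) ≤ C * RankTesting.queryScale s d ε *
          (1 + Real.log (RankTesting.queryScale s d ε)) ^ c) := by
  refine ⟨82944, 3, fun s d n m ε hs h0 h1 => ⟨?_,
    RankTesting.exists_rank_eq_tester_queryScale h0 h1 hs n m⟩⟩
  obtain ⟨A, hA, hq⟩ := RankTesting.exists_rank_le_tester_queryScale (d := d) h0 h1 hs n m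
  have hF := RankTesting.one_le_queryScale s d h0 h1
  have hlog := Real.log_nonneg hF
  refine ⟨A, hA, hq.trans ?_⟩
  gcongr
  norm_num
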